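/- Let $a<b$ be coprime positive integers and write $[n]=\{1,\dots,n\}$. **Rational noncrossing partitions.** An $a,b$-Dyck path is a lattice path $D$ from $(0,0)$ to $(b,a)$ with unit north and east steps that stays weakly above the line $y=\frac ab x$. A valley of $D$ is a lattice point of $D$ immediately preceded by an east step and immediately followed by a north step. From each valley $P$ of $D$ fire a laser: the line segment of slope $\frac ab$ that starts at $P$ and continues northeast until it first meets $D$ again. Label the east ends of the non-terminal east steps of $D$ from left to right by $1,\dots,b-1$, and regard each label as lying slightly below its lattice point. Let $\pi(D)$ be the set partition of $[b-1]$ in which $k\sim l$ if and only if no laser separates the labels $k$ and $l$; here a laser separates two labels if exactly one of them lies above it, i.e. vertically above one of its points. Set $\mathsf{NC}(a,b)=\{\pi(D): D \text{ an } a,b\text{-Dyck path}\}$. **Admissible lasers.** Set $$A(a,b)=\left\{(i,j)\ :\ 1\le i<j\le b-1 \text{ and } j-i=\left\lfloor \tfrac{rb}{a}\right\rfloor \text{ for some } r\in\{1,\dots,a-1\}\right\}.$$ **Kreweras complement.** A set partition of a linearly ordered set is noncrossing if $i<j<k<l$, $i\sim k$ and $j\sim l$ imply $i\sim j\sim k\sim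 l$. For a noncrossing partition $\pi$ of $[n]$, order the $2n$ vertices as $1<1'<2<2'<\dots<n<n'$; the Kreweras complement $\mathtt{krew}(\pi)$ is the coarsest partition of the primed vertices $1',\dots,n'$ (identified with $[n]$) which together with $\pi$ drawn on the unprimed vertices gives a noncrossing partition of the $2n$ vertices. **Proposition.** Let $\pi$ be a noncrossing partition of $[b-1]$. Then $\pi\in\mathsf{NC}(a,b)$ if and only if for every block $B$ of $\mathtt{krew}(\pi)$ the following two conditions hold: 1. $(i,\max(B))\in A(a,b)$ for every nonmaximal element $i\in B$; 2. for any two nonmaximal elements $i<j$ of $B$, $$\left\lceil(\max(B)-i)\tfrac ab\right\rceil-\left\lceil(\max(B)-j)\tfrac ab\right\rceil>(j-i)\tfrac ab .$$ -/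

import Mathlib

namespace RatNC

/-! ### Noncrossing partitions of `{1, …, n}` and the Kreweras complement -/

/-- Two elements lie in a common block of the set partition `π`. -/
def SameBlock {α : Type*} [DecidableEq α] {s : Finset α} (π : Finpartition s) (i j : α) : Prop :=
  ∃ B ∈ π.parts, i ∈ B ∧ j ∈ B

/-- A relation on an ordered set is noncrossing if `i < j < k < l`, `i ∼ k` and `j ∼ l`
imply `i ∼ j ∼ k ∼ l`. -/
def NoncrossingRel {α : Type*} [LT α] (r : α → α → Prop) : Prop :=
  ∀ i j k l : α, i < j → j < k → k < l → r i k → r j l → r i j ∧ r j k ∧ r k l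

/-- A set partition of `[n] = {1, …, n}` is noncrossing. -/
def IsNoncrossing {n : ℕ} (π : Finpartition (Finset.Icc 1 n)) : Prop :=
  NoncrossingRel (SameBlock π)

/-- The vertices `1 < 1' < 2 < 2' < ⋯` are modelled by pairs `(i, c)` in lexicographic order:
`(i, false)` is the unprimed vertex `i` and `(i, true)` is the primed vertex `i'`.
The relation draws `π` on the unprimed and `σ` on the primed vertices. -/
def mergedRel {n : ℕ} (π σ : Finpartition (Finset.Icc 1 n)) (x y : ℕ ×ₗ Bool) : Prop :=
  ((ofLex x).2 = false ∧ (ofLex y).2 = false ∧ SameBlock π (ofLex x).1 (ofLex y).1) ∨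
  ((ofLex x).2 = true ∧ (ofLex y).2 = true ∧ SameBlock σ (ofLex x).1 (ofLex y).1)

/-- `κ` is the coarsest partition of the primed vertices which introduces no crossings when it is
drawn together with `π` (for finpartitions, `σ ≤ κ` means that `σ` refines `κ`). -/
def IsKreweras {n : ℕ} (π κ : Finpartition (Finset.Icc 1 n)) : Prop :=
  IsGreatest {σ | NoncrossingRel (mergedRel π σ)} κ

/-- `i'` and `j'` can be joined: every block of `π` lies on one side of the chord between them. -/
def krewSetoid {n : ℕ} (π : Finpartition (Finset.Icc 1 n)) : Setoid ℕ where
  r i j := ∀ x y, SameBlock π x y → ((i < x ↔ j < x) ↔ (i < y ↔ j < y))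
  iseqv :=
    { refl := by intro i x y _; simp
      symm := by intro i j h x y hxy; have := h x y hxy; tauto
      trans := by
        intro i j k h1 h2 x y hxy
        have := h1 x y hxy
        have := h2 x y hxy
        tauto }

theorem SameBlock.symm {α : Type*} [DecidableEq α] {s : Finset α} {π : Finpartition s} {i j : α}
    (h : SameBlock π i j) : SameBlock π j i := by
  obtain ⟨B, hB, hi, hj⟩ := h
  exact ⟨B, hB, hj, hi⟩

theorem not_straddle {n : ℕ} {π σ : Finpartition (Finset.Icc 1 n)}
    (h : NoncrossingRel (mergedRel π σ)) {i j x y : ℕ} (hij : SameBlock σ i j)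
    (hxy : SameBlock π x y) (h1 : i < x) (h2 : x ≤ j) (h3 : y ≤ i ∨ j < y) : False := by
  rcases h3 with h3 | h3
  · have := (h (toLex (y, false)) (toLex (i, true)) (toLex (x, false)) (toLex (j, true))
      (by simp [Prod.Lex.toLex_lt_toLex]; omega) (by simp [Prod.Lex.toLex_lt_toLex]; omega)
      (by simp [Prod.Lex.toLex_lt_toLex]; omega)
      (Or.inl ⟨rfl, rfl, hxy.symm⟩) (Or.inr ⟨rfl, rfl, hij⟩)).1
    simp [mergedRel] at this
  · have := (h (toLex (i, true)) (toLex (x, false)) (toLex (j, true)) (toLex (y, false))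
      (by simp [Prod.Lex.toLex_lt_toLex]; omega) (by simp [Prod.Lex.toLex_lt_toLex]; omega)
      (by simp [Prod.Lex.toLex_lt_toLex]; omega)
      (Or.inr ⟨rfl, rfl, hij⟩) (Or.inl ⟨rfl, rfl, hxy⟩)).1
    simp [mergedRel] at this

open Classical in
theorem exists_isKreweras {n : ℕ} (π : Finpartition (Finset.Icc 1 n)) (hπ : IsNoncrossing π) :
    ∃ κ, IsKreweras π κ := by
  have key : ∀ i j, SameBlock (Finpartition.ofSetSetoid (krewSetoid π) (Finset.Icc 1 n)) i j ↔
      i ∈ Finset.Icc 1 n ∧ j ∈ Finset.Icc 1 n ∧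
        ∀ x y, SameBlock π x y → ((i < x ↔ j < x) ↔ (i < y ↔ j < y)) := by
    intro i j
    have := Finpartition.mem_part_ofSetSetoid_iff_rel (s := krewSetoid π) (Finset.Icc 1 n)
      (a := i) (b := j)
    rw [Finpartition.mem_part_iff_exists] at this
    refine Iff.trans ?_ this
    exact ⟨fun ⟨B, h, h1, h2⟩ => ⟨B, h, h2, h1⟩, fun ⟨B, h, h1, h2⟩ => ⟨B, h, h2, h1⟩⟩
  refine ⟨Finpartition.ofSetSetoid (krewSetoid π) (Finset.Icc 1 n), ?_, ?_⟩
  · rintro ⟨i, ci⟩ ⟨j, cj⟩ ⟨k, ck⟩ ⟨l, cl⟩ hij hjk hkl hik hjl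
    change toLex (i, ci) < toLex (j, cj) at hij
    change toLex (j, cj) < toLex (k, ck) at hjk
    change toLex (k, ck) < toLex (l, cl) at hkl
    rw [Prod.Lex.toLex_lt_toLex] at hij hjk hkl
    rcases hik with ⟨h1, h2, hik⟩ | ⟨h1, h2, hik⟩ <;>
      rcases hjl with ⟨h3, h4, hjl⟩ | ⟨h3, h4, hjl⟩
    all_goals
      change ci = _ at h1
      change ck = _ at h2
      change cj = _ at h3
      change cl = _ at h4
      subst h1 h2 h3 h4
      simp [show ¬ (true < false) by decide] at hij hjk hkl
    · obtain ⟨h1, h2, h3⟩ := hπ i j k l hij hjk hkl hik hjl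
      exact ⟨Or.inl ⟨rfl, rfl, h1⟩, Or.inl ⟨rfl, rfl, h2⟩, Or.inl ⟨rfl, rfl, h3⟩⟩
    · have h := ((key j l).1 hjl).2.2 i k hik
      omega
    · have h := ((key i k).1 hik).2.2 j l hjl
      omega
    · obtain ⟨mi, mk, hik⟩ := (key i k).1 hik
      obtain ⟨mj, ml, hjl⟩ := (key j l).1 hjl
      have e : ∀ x y, SameBlock π x y → ((j < x ↔ k < x) ↔ (j < y ↔ k < y)) := by
        intro x y hxy
        have h1 := hik x y hxy
        have h2 := hjl x y hxy
        have q : ∀ z, (j < z ↔ k < z) ↔ ((i < z ↔ k < z) ∨ (j < z ↔ l < z)) := by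
          intro z
          omega
        rw [q x, q y, h1, h2]
      have hij' := (key i j).2 ⟨mi, mj, (krewSetoid π).trans hik ((krewSetoid π).symm e)⟩
      have hjk' := (key j k).2 ⟨mj, mk, e⟩
      have hkl' := (key k l).2 ⟨mk, ml, (krewSetoid π).trans ((krewSetoid π).symm e) hjl⟩
      exact ⟨Or.inr ⟨rfl, rfl, hij'⟩, Or.inr ⟨rfl, rfl, hjk'⟩, Or.inr ⟨rfl, rfl, hkl'⟩⟩
  · intro σ hσ B hB
    obtain ⟨b, hb⟩ := σ.nonempty_of_mem_parts hB
    have hs : ∀ c ∈ B, c ∈ Finset.Icc 1 n := fun c hc => σ.le hB hc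
    refine ⟨(Finpartition.ofSetSetoid (krewSetoid π) (Finset.Icc 1 n)).part b,
      Finpartition.part_mem _ |>.2 (hs b hb), ?_⟩
    intro c hc
    rw [Finpartition.mem_part_ofSetSetoid_iff_rel]
    refine ⟨hs b hb, hs c hc, ?_⟩
    intro x y hxy
    have s1 : SameBlock σ b c := ⟨B, hB, hb, hc⟩
    have n1 : ¬ (b < x ∧ x ≤ c ∧ (y ≤ b ∨ c < y)) :=
      fun t => not_straddle hσ s1 hxy t.1 t.2.1 t.2.2
    have n2 : ¬ (c < x ∧ x ≤ b ∧ (y ≤ c ∨ b < y)) :=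
      fun t => not_straddle hσ s1.symm hxy t.1 t.2.1 t.2.2
    have n3 : ¬ (b < y ∧ y ≤ c ∧ (x ≤ b ∨ c < x)) :=
      fun t => not_straddle hσ s1 hxy.symm t.1 t.2.1 t.2.2
    have n4 : ¬ (c < y ∧ y ≤ b ∧ (x ≤ c ∨ b < x)) :=
      fun t => not_straddle hσ s1.symm hxy.symm t.1 t.2.1 t.2.2
    by_cases p : b < x <;> by_cases p' : c < x <;> by_cases q : b < y <;> by_cases q' : c < y <;>
      simp only [p, p', q, q'] <;> omega

/-- The Kreweras complement of a noncrossing partition. -/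
noncomputable def krew {n : ℕ} (π : Finpartition (Finset.Icc 1 n)) (hπ : IsNoncrossing π) :
    Finpartition (Finset.Icc 1 n) :=
  (exists_isKreweras π hπ).choose

theorem krew_spec {n : ℕ} (π : Finpartition (Finset.Icc 1 n)) (hπ : IsNoncrossing π) :
    IsKreweras π (krew π hπ) :=
  (exists_isKreweras π hπ).choose_spec

/-! ### Rational Dyck paths -/

/-- A unit step of a lattice path. -/
inductive Step where
  | north
  | east
  deriving DecidableEq

/-- The lattice point reached from `(0, 0)` after the first `p` steps of the word `w`. -/
def vertex (w : List Step) (p : ℕ) : ℕ × ℕ :=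
  ((w.take p).count Step.east, (w.take p).count Step.north)

/-- An `a,b`-Dyck path: a lattice path with north and east steps from `(0, 0)` to `(b, a)` all of
whose vertices lie weakly above the line `y = (a / b) x`. -/
structure DyckPath (a b : ℕ) where
  steps : List Step
  count_north : steps.count Step.north = a
  count_east : steps.count Step.east = b
  above : ∀ p : ℕ, a * (vertex steps p).1 ≤ b * (vertex steps p).2

/-- The closed unit segment in the plane traversed by a step starting at `v`. -/
def Step.segment : Step → ℕ × ℕ → Set (ℝ × ℝ)
  | .north, v => {q | q.1 = v.1 ∧ (v.2 : ℝ) ≤ q.2 ∧ q.2 ≤ v.2 + 1}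
  | .east, v => {q | q.2 = v.2 ∧ (v.1 : ℝ) ≤ q.1 ∧ q.1 ≤ v.1 + 1}

/-- The point at parameter `s` on the ray of slope `a / b` going northeast from `v`. -/
def ray (a b : ℕ) (v : ℕ × ℕ) (s : ℝ) : ℝ × ℝ := (v.1 + s * b, v.2 + s * a)

namespace DyckPath

variable {a b : ℕ}

/-- The path as a subset of the plane. -/
def trace (D : DyckPath a b) : Set (ℝ × ℝ) :=
  {q | ∃ (p : ℕ) (s : Step), D.steps[p]? = some s ∧ q ∈ s.segment (vertex D.steps p)}

/-- A valley: a vertex immediately preceded by an east step and followed by a north step. -/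
def IsValley (D : DyckPath a b) (v : ℕ × ℕ) : Prop :=
  ∃ p : ℕ, D.steps[p]? = some Step.east ∧ D.steps[p + 1]? = some Step.north ∧
    v = vertex D.steps (p + 1)

/-- The lasers fired from the valleys of `D`: the segment of slope `a / b` which starts at a valley
and continues northeast until it first meets the path again. -/
def IsLaser (D : DyckPath a b) (L : Set (ℝ × ℝ)) : Prop :=
  ∃ v, D.IsValley v ∧ ∃ t : ℝ, 0 < t ∧ ray a b v t ∈ D.trace ∧
    (∀ s : ℝ, 0 < s → s < t → ray a b v s ∉ D.trace) ∧
    L = ray a b v '' Set.Icc 0 t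

/-- The label `k` sits slightly below the east end of the `k`-th east step. It lies above `L` if
`L` has a point vertically below it. As the label is slightly below its lattice point `(k, y)`,
such a point of `L` has height strictly less than `y`. -/
def LabelAbove (D : DyckPath a b) (k : ℕ) (L : Set (ℝ × ℝ)) : Prop :=
  ∃ p : ℕ, D.steps[p]? = some Step.east ∧ (vertex D.steps (p + 1)).1 = k ∧
    ∃ q ∈ L, q.1 = k ∧ q.2 < (vertex D.steps (p + 1)).2

/-- The visibility relation: no laser separates the labels `k` and `l`. A laser is a chord of the
region below the path; it separates two labels if exactly one of them lies above it. -/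
def visibility (D : DyckPath a b) : Setoid ℕ where
  r k l := ∀ L, D.IsLaser L → (D.LabelAbove k L ↔ D.LabelAbove l L)
  iseqv :=
    { refl := fun _ _ _ => Iff.rfl
      symm := fun h L hL => (h L hL).symm
      trans := fun h h' L hL => (h L hL).trans (h' L hL) }

open Classical in
/-- The partition `π(D)` of `[b - 1]` into visibility classes. -/
noncomputable def partition (D : DyckPath a b) : Finpartition (Finset.Icc 1 (b - 1)) :=
  Finpartition.ofSetSetoid D.visibility (Finset.Icc 1 (b - 1))

end DyckPath

/-- The set `NC(a,b)` of `a,b`-noncrossing partitions of `[b - 1]`. -/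
def rationalNC (a b : ℕ) : Set (Finpartition (Finset.Icc 1 (b - 1))) :=
  Set.range (DyckPath.partition (a := a) (b := b))

/-- The set `A(a,b)` of admissible lasers. -/
def admissibleLasers (a b : ℕ) : Set (ℕ × ℕ) :=
  {ij | 1 ≤ ij.1 ∧ ij.1 < ij.2 ∧ ij.2 ≤ b - 1 ∧
    ∃ r : ℕ, 1 ≤ r ∧ r ≤ a - 1 ∧ (ij.2 : ℤ) - ij.1 = ⌊(r * b : ℝ) / a⌋}

end RatNC

namespace RatNC

/-! Let `h k` be the height of the `k`-th east step and `c k = b * h k - a * k` (`excess`). The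
laser from a valley `i` passes below the labels before the first `e > i` with `c e ≤ c i`, so it
cuts off the interval `(i, e - 1]` (`AboveChord`); `visibility_iff` replaces the geometry by these
intervals. Dually, for `i < j`, `i'` and `j'` share a Kreweras block iff `(i, j]` is a union of
blocks of `π` (`sameBlock_krew_iff`), and these intervals determine `π`
(`sameBlock_of_not_separated`).

Given `D` and a Kreweras block with maximum `m`, the laser of every other element `i` ends right
after label `m`: `c (m + 1) ≤ c i < c k` for `i < k ≤ m` (`excess_of_mem_krew`). As `c` drops by at
most `a` per step and coprimality excludes equality, `0 < c m - c i < a`. With `r = h m - h i` this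
reads `0 < b * r - a * (m - i) < a`: the pair is admissible and, as `a < b`, `r = ⌈(m - i) * a /
b⌉`. Condition 2 then says `c i < c j`, which holds because label `j` is above the laser of `i`.

Conversely, admissibility prescribes `c m - c i` within each block. Letting `c` drop by `a` after
each maximum determines `h` backwards from `h b = a`. Nesting of the blocks and condition 2 make the
chord of `i` exactly `(i, m]` (`exists_height_of_chords`), so the resulting path has partition `π`.
-/

theorem sameBlock_ofSetSetoid_iff {α : Type*} [DecidableEq α] (S : Setoid α)
    [DecidableRel S.r] (s : Finset α) (i j : α) :
    SameBlock (Finpartition.ofSetSetoid S s) i j ↔ i ∈ s ∧ j ∈ s ∧ S i j := by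
  have := Finpartition.mem_part_ofSetSetoid_iff_rel (s := S) s (a := i) (b := j)
  rw [Finpartition.mem_part_iff_exists] at this
  refine Iff.trans ?_ this
  exact ⟨fun ⟨B, h, h1, h2⟩ => ⟨B, h, h2, h1⟩, fun ⟨B, h, h1, h2⟩ => ⟨B, h, h2, h1⟩⟩

/-! ### Heights of the east steps of a lattice path -/

/-- The number of north steps which precede the `k`-th east step of a word. -/
def eastHeight : List Step → ℕ → ℕ
  | _, 0 => 0
  -- Past the last east step the value is thus the total number of north steps, which keeps the
  -- function monotone.
  | [], _ + 1 => 0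
  | Step.north :: w, k + 1 => eastHeight w (k + 1) + 1
  | Step.east :: w, k + 1 => eastHeight w k

@[simp] theorem eastHeight_zero (w : List Step) : eastHeight w 0 = 0 := by
  unfold eastHeight; rfl

@[simp] theorem vertex_zero (w : List Step) : vertex w 0 = (0, 0) := by simp [vertex]

@[simp] theorem vertex_north_cons (w : List Step) (p : ℕ) :
    vertex (Step.north :: w) (p + 1) = ((vertex w p).1, (vertex w p).2 + 1) := by
  simp [vertex]

@[simp] theorem vertex_east_cons (w : List Step) (p : ℕ) :
    vertex (Step.east :: w) (p + 1) = ((vertex w p).1 + 1, (vertex w p).2) := by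
  simp [vertex]

theorem vertex_succ_of_east {w : List Step} {p : ℕ} (h : w[p]? = some Step.east) :
    vertex w (p + 1) = ((vertex w p).1 + 1, (vertex w p).2) := by
  simp [vertex, List.take_add_one, h]

theorem vertex_succ_of_north {w : List Step} {p : ℕ} (h : w[p]? = some Step.north) :
    vertex w (p + 1) = ((vertex w p).1, (vertex w p).2 + 1) := by
  simp [vertex, List.take_add_one, h]

theorem eastHeight_le_succ (w : List Step) (k : ℕ) : eastHeight w k ≤ eastHeight w (k + 1) := by
  induction w generalizing k with
  | nil => cases k <;> simp [eastHeight]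
  | cons s w ih =>
    cases k with
    | zero => simp
    | succ k => cases s <;> simp [eastHeight, ih]

theorem eastHeight_mono (w : List Step) : Monotone (eastHeight w) :=
  monotone_nat_of_le_succ (eastHeight_le_succ w)

theorem eastHeight_le_count (w : List Step) (k : ℕ) : eastHeight w k ≤ w.count Step.north := by
  induction w generalizing k with
  | nil => cases k <;> simp [eastHeight]
  | cons s w ih =>
    cases k with
    | zero => simp
    | succ k => cases s <;> simp [eastHeight, ih]

theorem eastHeight_append {w : List Step} (v : List Step) {k : ℕ} (hk : k ≤ w.count Step.east) :
    eastHeight (w ++ v) k = eastHeight w k := by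
  induction w generalizing k with
  | nil => simp at hk; simp [hk]
  | cons s w ih =>
    cases k with
    | zero => simp
    | succ k =>
      cases s
      · simp at hk; simp [eastHeight, ih hk]
      · simp at hk; simp [eastHeight, ih hk]

theorem vertex_snd_of_east {w : List Step} {p : ℕ} (h : w[p]? = some Step.east) :
    (vertex w p).2 = eastHeight w ((vertex w p).1 + 1) := by
  induction w generalizing p with
  | nil => simp at h
  | cons s w ih =>
    cases p with
    | zero => simp at h; simp [h, eastHeight]
    | succ p => simp at h; cases s <;> simp [eastHeight, ih h]

theorem eastHeight_le_vertex_snd (w : List Step) (p : ℕ) :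
    eastHeight w (vertex w p).1 ≤ (vertex w p).2 := by
  induction w generalizing p with
  | nil => simp [vertex]
  | cons s w ih =>
    cases p with
    | zero => simp
    | succ p =>
      cases s
      · simp only [vertex_north_cons]
        have := ih p
        generalize (vertex w p).1 = x at *
        cases x <;> simp [eastHeight, *]
      · simp [eastHeight, ih]

theorem vertex_snd_lt_of_north {w : List Step} {p : ℕ} (h : w[p]? = some Step.north)
    (hx : (vertex w p).1 < w.count Step.east) :
    (vertex w p).2 < eastHeight w ((vertex w p).1 + 1) := by
  induction w generalizing p with
  | nil => simp at h
  | cons s w ih =>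
    cases p with
    | zero => simp at h; simp [h, eastHeight]
    | succ p =>
      simp at h
      cases s
      · simp at hx; simp [eastHeight, ih h hx]
      · simp at hx; simp [eastHeight, ih h hx]

theorem exists_east_step {w : List Step} {k : ℕ} (hk : k < w.count Step.east) :
    ∃ p : ℕ, w[p]? = some Step.east ∧ (vertex w p).1 = k := by
  induction w generalizing k with
  | nil => simp at hk
  | cons s w ih =>
    cases s
    · simp at hk
      obtain ⟨p, h1, h2⟩ := ih hk
      exact ⟨p + 1, by simpa using h1, by simpa using h2⟩
    · cases k with
      | zero => exact ⟨0, by simp, by simp⟩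
      | succ k =>
        simp at hk
        obtain ⟨p, h1, h2⟩ := ih hk
        exact ⟨p + 1, by simpa using h1, by simpa using h2⟩

/-- The word whose `k`-th east step has height `h k`, for `k ≤ n`. -/
def wordOfHeights (h : ℕ → ℕ) : ℕ → List Step
  | 0 => []
  | n + 1 => wordOfHeights h n ++ (List.replicate (h (n + 1) - h n) Step.north ++ [Step.east])

theorem count_east_wordOfHeights (h : ℕ → ℕ) (n : ℕ) :
    (wordOfHeights h n).count Step.east = n := by
  induction n with
  | zero => rfl
  | succ n ih => simp [wordOfHeights, ih, List.count_replicate]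

theorem count_north_wordOfHeights {h : ℕ → ℕ} (h0 : h 0 = 0) (hm : Monotone h) (n : ℕ) :
    (wordOfHeights h n).count Step.north = h n := by
  induction n with
  | zero => simp [wordOfHeights, h0]
  | succ n ih =>
    have := hm (Nat.le_add_right n 1)
    simp [wordOfHeights, ih]
    omega

theorem eastHeight_replicate_north (d : ℕ) :
    ∀ k, eastHeight (List.replicate d Step.north ++ [Step.east]) (k + 1) = d := by
  induction d with
  | zero => intro k; cases k <;> simp [eastHeight]
  | succ d ih => intro k; simp [List.replicate_succ, eastHeight, ih]

theorem eastHeight_append_add (w v : List Step) (k : ℕ) :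
    eastHeight (w ++ v) (w.count Step.east + (k + 1)) =
      w.count Step.north + eastHeight v (k + 1) := by
  induction w with
  | nil => simp
  | cons s w ih =>
    cases s
    · simp only [List.cons_append, List.count_cons]
      simp [← add_assoc, eastHeight] at ih ⊢
      omega
    · simp [← add_assoc, eastHeight] at ih ⊢
      rw [add_right_comm, ih]

theorem eastHeight_wordOfHeights {h : ℕ → ℕ} (h0 : h 0 = 0) (hm : Monotone h) {n k : ℕ}
    (hk : k ≤ n) : eastHeight (wordOfHeights h n) k = h k := by
  induction n with
  | zero => simp at hk; simp [hk, h0]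
  | succ n ih =>
    rcases Nat.lt_or_ge n k with h1 | h1
    · obtain rfl : k = n + 1 := by omega
      have := eastHeight_append_add (wordOfHeights h n)
        (List.replicate (h (n + 1) - h n) Step.north ++ [Step.east]) 0
      rw [count_east_wordOfHeights, count_north_wordOfHeights h0 hm,
        eastHeight_replicate_north] at this
      have := hm (Nat.le_add_right n 1)
      simp only [wordOfHeights]
      simp_all
    · rw [wordOfHeights, eastHeight_append _ (by rw [count_east_wordOfHeights]; exact h1), ih h1]

/-- `b` times the vertical distance between the east end `(k, h k)` of the `k`-th east step and
the line `y = (a / b) x`. -/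
def excess (a b : ℕ) (h : ℕ → ℕ) (k : ℕ) : ℤ := b * h k - a * k

/-- The label `x` lies above the chord which starts at `i` and ends before the first later
position where `c` does not exceed `c i`. -/
def AboveChord (c : ℕ → ℤ) (i x : ℕ) : Prop := i < x ∧ ∀ k, i < k → k ≤ x → c i < c k

/-! ### Lasers and visibility in terms of the excess -/

namespace DyckPath

variable {a b : ℕ}

/-- The height of the `k`-th east step of `D`. -/
def height (D : DyckPath a b) (k : ℕ) : ℕ := eastHeight D.steps k

theorem height_mono (D : DyckPath a b) : Monotone D.height := eastHeight_mono _

theorem height_zero (D : DyckPath a b) : D.height 0 = 0 := eastHeight_zero _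

theorem height_le (D : DyckPath a b) (k : ℕ) : D.height k ≤ a :=
  (eastHeight_le_count _ k).trans_eq D.count_north

theorem vertex_succ_of_east (D : DyckPath a b) {p : ℕ} (h : D.steps[p]? = some Step.east) :
    vertex D.steps (p + 1) = ((vertex D.steps p).1 + 1, D.height ((vertex D.steps p).1 + 1)) := by
  rw [RatNC.vertex_succ_of_east h, height, ← vertex_snd_of_east h]

theorem vertex_fst_le (D : DyckPath a b) (p : ℕ) : (vertex D.steps p).1 ≤ b := by
  conv_rhs => rw [← D.count_east]
  exact (List.take_sublist p D.steps).count_le _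

theorem vertex_snd_le (D : DyckPath a b) (p : ℕ) : (vertex D.steps p).2 ≤ a := by
  conv_rhs => rw [← D.count_north]
  exact (List.take_sublist p D.steps).count_le _

theorem exists_east_step (D : DyckPath a b) {k : ℕ} (h1 : 1 ≤ k) (h2 : k ≤ b) :
    ∃ p : ℕ, D.steps[p]? = some Step.east ∧ vertex D.steps (p + 1) = (k, D.height k) := by
  obtain ⟨p, hp, hk⟩ := RatNC.exists_east_step (w := D.steps) (k := k - 1)
    (by rw [D.count_east]; omega)
  refine ⟨p, hp, ?_⟩
  rw [D.vertex_succ_of_east hp, hk, Nat.sub_add_cancel h1]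

theorem excess_nonneg (D : DyckPath a b) {k : ℕ} (hk : k ≤ b) : 0 ≤ excess a b D.height k := by
  rcases Nat.eq_zero_or_pos k with rfl | h1
  · simp [excess, D.height_zero]
  · obtain ⟨p, -, hp⟩ := D.exists_east_step h1 hk
    have := D.above (p + 1)
    rw [hp] at this
    simp only [excess]
    have : (a * k : ℤ) ≤ b * D.height k := by exact_mod_cast this
    omega

/-- Lying above the diagonal at abscissa `b` forces all `a` north steps to precede the last east
step. -/
theorem height_last (D : DyckPath a b) (hb : 0 < b) : D.height b = a := by
  have h1 := D.excess_nonneg le_rfl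
  refine le_antisymm (D.height_le b) ?_
  simp only [excess] at h1
  have h2 : (b * a : ℤ) ≤ b * D.height b := by linarith
  exact_mod_cast le_of_mul_le_mul_left h2 (by exact_mod_cast hb)

theorem excess_pos (D : DyckPath a b) (hcop : Nat.Coprime a b) {k : ℕ} (h1 : 1 ≤ k)
    (h2 : k < b) : 0 < excess a b D.height k := by
  refine lt_of_le_of_ne (D.excess_nonneg h2.le) fun h => ?_
  simp only [excess] at h
  have h3 : b * D.height k = a * k := by
    have : (b * D.height k : ℤ) = a * k := by linarith
    exact_mod_cast this
  have := hcop.symm.dvd_of_dvd_mul_left (Dvd.intro _ h3)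
  exact absurd (Nat.le_of_dvd h1 this) (by omega)

theorem isValley_iff (D : DyckPath a b) (v : ℕ × ℕ) :
    D.IsValley v ↔ ∃ i, 1 ≤ i ∧ i < b ∧ v = (i, D.height i) ∧ D.height i < D.height (i + 1) := by
  constructor
  · rintro ⟨p, h1, h2, rfl⟩
    have hv := D.vertex_succ_of_east h1
    -- At abscissa `b` the path already has height `a`, so no north step can follow.
    have hb : (vertex D.steps (p + 1)).1 < b := by
      refine lt_of_le_of_ne (D.vertex_fst_le _) fun h => ?_
      have h3 := D.vertex_snd_le (p + 2)
      have h4 := D.above (p + 1)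
      rw [vertex_succ_of_north h2] at h3
      have h5 := D.vertex_fst_le (p + 1)
      have hb : 0 < b := by rw [← h, hv]; simp
      rw [h, mul_comm] at h4
      have := le_of_mul_le_mul_left h4 hb
      simp at h3
      omega
    have h3 := vertex_snd_lt_of_north h2 (by rw [D.count_east]; exact hb)
    rw [hv] at h3 hb ⊢
    exact ⟨_, by omega, hb, rfl, h3⟩
  · rintro ⟨i, h1, h2, rfl, h3⟩
    obtain ⟨p, hp, hv⟩ := D.exists_east_step h1 h2.le
    refine ⟨p, hp, ?_, hv.symm⟩
    rcases hs : D.steps[p + 1]? with _ | _ | _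
    · have := List.getElem?_eq_none_iff.1 hs
      simp only [vertex, List.take_of_length_le this, D.count_east, Prod.mk.injEq] at hv
      omega
    · rfl
    · have := vertex_snd_of_east hs
      rw [hv] at this
      simp only [height] at h3 this
      omega

/-- A point of the path whose abscissa lies in `(i, ∞)` is reached only after the path has stopped
exceeding the line through `(i, h i)`. -/
theorem exists_of_mem_trace (D : DyckPath a b) {i : ℕ} {q : ℝ × ℝ} (hq : q ∈ D.trace)
    (hi : (i : ℝ) < q.1) (hh : (D.height i : ℝ) < q.2) :
    ∃ k : ℕ, i < k ∧ k ≤ b ∧ q.1 ≤ k ∧ (D.height k : ℝ) ≤ q.2 := by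
  obtain ⟨p, s, hs, hq⟩ := hq
  cases s
  · obtain ⟨h1, h2, h3⟩ := hq
    refine ⟨(vertex D.steps p).1, by rw [h1] at hi; exact_mod_cast hi, D.vertex_fst_le _, h1.le,
      le_trans ?_ h2⟩
    exact_mod_cast eastHeight_le_vertex_snd D.steps p
  · obtain ⟨h1, h2, h3⟩ := hq
    have hv := D.vertex_succ_of_east hs
    have hb := D.vertex_fst_le (p + 1)
    rw [hv] at hb
    have he : (vertex D.steps p).2 = D.height ((vertex D.steps p).1 + 1) := vertex_snd_of_east hs
    rw [he] at h1
    refine ⟨(vertex D.steps p).1 + 1, ?_, hb, by exact_mod_cast h3, h1.ge⟩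
    rw [h1] at hh
    have : D.height i < D.height ((vertex D.steps p).1 + 1) := by exact_mod_cast hh
    -- Heights are monotone, so an east step higher than `h i` must come after the `i`-th.
    by_contra hc
    have := D.height_mono (not_lt.1 hc)
    omega

theorem excess_last (D : DyckPath a b) (hb : 0 < b) : excess a b D.height b = 0 := by
  simp only [excess, D.height_last hb]
  ring

/-- Moving one unit east costs `a`, and the height never decreases. -/
theorem excess_succ_ge (D : DyckPath a b) (k : ℕ) :
    excess a b D.height k - a ≤ excess a b D.height (k + 1) := by
  have : (D.height k : ℤ) ≤ D.height (k + 1) := by exact_mod_cast D.height_mono k.le_succ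
  have := mul_le_mul_of_nonneg_left this (Int.natCast_nonneg b)
  simp only [excess]
  push_cast
  linarith

/-- A single north step already contributes `b`, more than the loss `a`. So valleys are exactly the
ascents of the excess. -/
theorem excess_lt_succ_iff (D : DyckPath a b) (ha : 0 < a) (hab : a < b) (i : ℕ) :
    excess a b D.height i < excess a b D.height (i + 1) ↔ D.height i < D.height (i + 1) := by
  simp only [excess]
  push_cast
  constructor
  · intro h
    by_contra hc
    have h1 : (D.height (i + 1) : ℤ) ≤ D.height i := by exact_mod_cast not_lt.1 hc
    have := mul_le_mul_of_nonneg_left h1 (Int.natCast_nonneg b)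
    have : (0 : ℤ) < a := by exact_mod_cast ha
    linarith
  · intro h
    have h1 : (D.height i : ℤ) + 1 ≤ D.height (i + 1) := by exact_mod_cast h
    have := mul_le_mul_of_nonneg_left h1 (Int.natCast_nonneg b)
    have : (a : ℤ) < b := by exact_mod_cast hab
    linarith

/-- The end of the laser fired from a valley. -/
theorem exists_laser_end (D : DyckPath a b) {i : ℕ} (hi : i < b) :
    ∃ e : ℕ, i < e ∧ e ≤ b ∧ excess a b D.height e ≤ excess a b D.height i ∧
      (∀ k, i < k → k < e → excess a b D.height i < excess a b D.height k) := by
  have hb : i < b ∧ excess a b D.height b ≤ excess a b D.height i :=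
    ⟨hi, by rw [D.excess_last (by omega)]; exact D.excess_nonneg hi.le⟩
  classical
  have hex : ∃ e, i < e ∧ excess a b D.height e ≤ excess a b D.height i := ⟨b, hb⟩
  refine ⟨Nat.find hex, (Nat.find_spec hex).1, Nat.find_min' hex hb, (Nat.find_spec hex).2, ?_⟩
  intro k h1 h2
  have := Nat.find_min hex h2
  by_contra hc
  exact this ⟨h1, not_lt.1 hc⟩

/-- East ends before `e` lie strictly above the ray, so the first hit is on the `e`-th east step,
whose height fixes the parameter. The assumption `i + 1 < e` makes `i` a valley. -/
theorem isLaser_iff (D : DyckPath a b) (ha : 0 < a) (hab : a < b) {i e : ℕ}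
    (hie : i + 1 < e) (heb : e ≤ b) (he : excess a b D.height e ≤ excess a b D.height i)
    (hlt : ∀ k, i < k → k < e → excess a b D.height i < excess a b D.height k) (t : ℝ) :
    (0 < t ∧ ray a b (i, D.height i) t ∈ D.trace ∧
      (∀ s : ℝ, 0 < s → s < t → ray a b (i, D.height i) s ∉ D.trace)) ↔
      t = ((D.height e : ℝ) - D.height i) / a := by
  have ha' : (0 : ℝ) < a := by exact_mod_cast ha
  have hb' : (0 : ℝ) < b := by exact_mod_cast ha.trans hab
  have hpos : 0 < ((D.height e : ℝ) - D.height i) / a := by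
    have h1 := (D.excess_lt_succ_iff ha hab i).1 (hlt _ (by omega) hie)
    have h2 := D.height_mono hie.le
    have : (D.height i : ℝ) < D.height e := by exact_mod_cast h1.trans_le h2
    exact div_pos (by linarith) ha'
  have hfirst : ∀ s : ℝ, 0 < s → ray a b (i, D.height i) s ∈ D.trace →
      ((D.height e : ℝ) - D.height i) / a ≤ s := by
    intro s hs hmem
    have hsa : 0 < s * a := by positivity
    have hsb : 0 < s * b := by positivity
    obtain ⟨k, h1, h2, h3, h4⟩ := D.exists_of_mem_trace (i := i) hmem
      (by simp only [ray]; linarith) (by simp only [ray]; linarith)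
    simp only [ray] at h3 h4
    have hek : e ≤ k := by
      by_contra hc
      have h5 := hlt k h1 (not_le.1 hc)
      simp only [excess] at h5
      have h6 : (b * D.height i : ℝ) - a * i < b * D.height k - a * k := by exact_mod_cast h5
      nlinarith
    have : (D.height e : ℝ) ≤ D.height k := by exact_mod_cast D.height_mono hek
    rw [div_le_iff₀ ha']
    linarith
  have hmem : ray a b (i, D.height i) (((D.height e : ℝ) - D.height i) / a) ∈ D.trace := by
    obtain ⟨p, hp, hv⟩ := D.exists_east_step (by omega : 1 ≤ e) heb
    rw [RatNC.vertex_succ_of_east hp, Prod.mk.injEq] at hv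
    have hv1 : ((vertex D.steps p).1 : ℝ) + 1 = e := by exact_mod_cast hv.1
    refine ⟨p, Step.east, hp, ?_, ?_, ?_⟩
    · simp only [ray, hv.2]
      field_simp
      ring
    -- The hit lies east of abscissa `e - 1`: the end of the previous east step is above the ray,
    -- and the `e`-th step is no lower.
    · have h5 := hlt (e - 1) (by omega) (by omega)
      simp only [excess] at h5
      have h6 : (b * D.height i : ℝ) - a * i < b * D.height (e - 1) - a * (e - 1 : ℕ) := by
        exact_mod_cast h5
      have h7 : (D.height (e - 1) : ℝ) ≤ D.height e := by
        exact_mod_cast D.height_mono (Nat.sub_le e 1)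
      have h8 := mul_le_mul_of_nonneg_left h7 hb'.le
      rw [Nat.cast_sub (by omega), Nat.cast_one] at h6
      have : (e - 1 - i : ℝ) ≤ ((D.height e : ℝ) - D.height i) / a * b := by
        rw [div_mul_eq_mul_div, le_div_iff₀ ha']
        linarith
      simp only [ray]
      linarith
    · simp only [excess] at he
      have h6 : (b * D.height e : ℝ) - a * e ≤ b * D.height i - a * i := by exact_mod_cast he
      have : ((D.height e : ℝ) - D.height i) / a * b ≤ (e - i : ℝ) := by
        rw [div_mul_eq_mul_div, div_le_iff₀ ha']
        linarith
      simp only [ray]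
      linarith
  constructor
  · rintro ⟨h1, h2, h3⟩
    refine le_antisymm ?_ (hfirst t h1 h2)
    by_contra hc
    exact h3 _ hpos (not_le.1 hc) hmem
  · rintro rfl
    exact ⟨hpos, hmem, fun s h1 h2 h3 => absurd (hfirst s h1 h3) (not_le.2 h2)⟩

/-- At abscissa `k` the ray is strictly below the lattice point iff the excess at `k` exceeds that
at `i`. Strictness puts label `e` below the laser even when the laser ends exactly at its lattice
point. -/
theorem labelAbove_iff (D : DyckPath a b) (ha : 0 < a) (hab : a < b) {i e : ℕ}
    (hie : i + 1 < e) (he : excess a b D.height e ≤ excess a b D.height i)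
    (hlt : ∀ k, i < k → k < e → excess a b D.height i < excess a b D.height k)
    {k : ℕ} (hk1 : 1 ≤ k) (hkb : k ≤ b) :
    D.LabelAbove k (ray a b (i, D.height i) ''
      Set.Icc 0 (((D.height e : ℝ) - D.height i) / a)) ↔
      AboveChord (excess a b D.height) i k := by
  have ha' : (0 : ℝ) < a := by exact_mod_cast ha
  have hb' : (0 : ℝ) < b := by exact_mod_cast ha.trans hab
  constructor
  · rintro ⟨p, hp, hv, q, ⟨s, ⟨hs0, hs1⟩, rfl⟩, hq1, hq2⟩
    have hv' := D.vertex_succ_of_east hp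
    rw [hv'] at hv hq2
    simp only at hv
    simp only [hv, ray] at hq1 hq2
    have hik : i ≤ k := by
      have : (i : ℝ) ≤ k := by rw [← hq1]; have := mul_nonneg hs0 hb'.le; linarith
      exact_mod_cast this
    have hck : excess a b D.height i < excess a b D.height k := by
      have : (b * D.height i : ℝ) - a * i < b * D.height k - a * k := by nlinarith
      simp only [excess]
      exact_mod_cast this
    have hke : k < e := by
      have h1 : k ≤ e := by
        have he' := he
        simp only [excess] at he'
        have h6 : (b * D.height e : ℝ) - a * e ≤ b * D.height i - a * i := by exact_mod_cast he'
        rw [le_div_iff₀ ha'] at hs1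
        have : (a * k : ℝ) ≤ a * e := by nlinarith
        exact_mod_cast le_of_mul_le_mul_left this ha'
      refine lt_of_le_of_ne h1 ?_
      rintro rfl
      omega
    refine ⟨lt_of_le_of_ne hik ?_, fun l h1 h2 => hlt l h1 (by omega)⟩
    rintro rfl
    exact lt_irrefl _ hck
  · rintro ⟨hik, hc⟩
    have hke : k < e := by
      by_contra h
      have := hc e (by omega) (not_lt.1 h)
      omega
    obtain ⟨p, hp, hv⟩ := D.exists_east_step hk1 hkb
    have hik' : (i : ℝ) < k := by exact_mod_cast hik
    have h5 := hc k hik le_rfl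
    simp only [excess] at h5
    have h6 : (b * D.height i : ℝ) - a * i < b * D.height k - a * k := by exact_mod_cast h5
    have h7 : (D.height k : ℝ) ≤ D.height e := by exact_mod_cast D.height_mono hke.le
    refine ⟨p, hp, by rw [hv], ray a b (i, D.height i) (((k : ℝ) - i) / b),
      ⟨_, ⟨div_nonneg (by linarith) hb'.le, ?_⟩, rfl⟩, ?_, ?_⟩
    · rw [div_le_div_iff₀ hb' ha']
      nlinarith
    · simp only [ray]
      field_simp
      ring
    · simp only [ray, hv]
      have : ((k : ℝ) - i) / b * a < D.height k - D.height i := by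
        rw [div_mul_eq_mul_div, div_lt_iff₀ hb']
        linarith
      linarith

/-- All `i ≥ 1` may be tested, not only valleys: without an ascent of the excess at `i`, no label is
above the chord of `i`. -/
theorem visibility_iff (D : DyckPath a b) (ha : 0 < a) (hab : a < b) {x y : ℕ}
    (hx : x ∈ Finset.Icc 1 (b - 1)) (hy : y ∈ Finset.Icc 1 (b - 1)) :
    D.visibility x y ↔ ∀ i, 1 ≤ i →
      (AboveChord (excess a b D.height) i x ↔ AboveChord (excess a b D.height) i y) := by
  rw [Finset.mem_Icc] at hx hy
  have hend : ∀ i, i < b → D.height i < D.height (i + 1) → ∃ e, i + 1 < e ∧ e ≤ b ∧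
      excess a b D.height e ≤ excess a b D.height i ∧
      (∀ k, i < k → k < e → excess a b D.height i < excess a b D.height k) := by
    intro i hib hh
    obtain ⟨e, h1, h2, h3, h4⟩ := D.exists_laser_end hib
    refine ⟨e, lt_of_le_of_ne h1 ?_, h2, h3, h4⟩
    rintro rfl
    have := (D.excess_lt_succ_iff ha hab i).2 hh
    exact absurd h3 (not_le.2 this)
  constructor
  · intro h i hi1
    by_cases hi : i < b ∧ D.height i < D.height (i + 1)
    · obtain ⟨e, h1, h2, h3, h4⟩ := hend i hi.1 hi.2
      have ht := (D.isLaser_iff ha hab h1 h2 h3 h4 _).2 rfl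
      have := h _ ⟨_, (D.isValley_iff _).2 ⟨i, hi1, hi.1, rfl, hi.2⟩, _, ht.1, ht.2.1, ht.2.2, rfl⟩
      rwa [D.labelAbove_iff ha hab h1 h3 h4 hx.1 (by omega),
        D.labelAbove_iff ha hab h1 h3 h4 hy.1 (by omega)] at this
    · have : ∀ z, 1 ≤ z → z ≤ b - 1 → ¬ AboveChord (excess a b D.height) i z := by
        rintro z hz1 hz2 ⟨h1, h2⟩
        exact hi ⟨by omega, (D.excess_lt_succ_iff ha hab i).1 (h2 _ (by omega) (by omega))⟩
      exact iff_of_false (this x hx.1 hx.2) (this y hy.1 hy.2)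
  · rintro h L ⟨v, hv, t, h1, h2, h3, rfl⟩
    obtain ⟨i, hi1, hib, rfl, hh⟩ := (D.isValley_iff v).1 hv
    obtain ⟨e, e1, e2, e3, e4⟩ := hend i hib hh
    rw [(D.isLaser_iff ha hab e1 e2 e3 e4 t).1 ⟨h1, h2, h3⟩,
      D.labelAbove_iff ha hab e1 e3 e4 hx.1 (by omega),
      D.labelAbove_iff ha hab e1 e3 e4 hy.1 (by omega)]
    exact h i hi1

theorem sameBlock_partition_iff (D : DyckPath a b) (ha : 0 < a) (hab : a < b) (x y : ℕ) :
    SameBlock D.partition x y ↔ x ∈ Finset.Icc 1 (b - 1) ∧ y ∈ Finset.Icc 1 (b - 1) ∧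
      ∀ i, 1 ≤ i →
        (AboveChord (excess a b D.height) i x ↔ AboveChord (excess a b D.height) i y) := by
  unfold partition
  rw [sameBlock_ofSetSetoid_iff, ← and_assoc, ← and_assoc]
  exact and_congr_right fun h => D.visibility_iff ha hab h.1 h.2

/-- The Dyck path with prescribed heights of its east steps. -/
theorem exists_of_height {h : ℕ → ℕ} (h0 : h 0 = 0) (hm : Monotone h) (hb : h b = a)
    (hc : ∀ k ≤ b, 0 ≤ excess a b h k) :
    ∃ D : DyckPath a b, ∀ k ≤ b, D.height k = h k := by
  refine ⟨⟨wordOfHeights h b, by rw [count_north_wordOfHeights h0 hm, hb],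
    count_east_wordOfHeights h b, fun p => ?_⟩, fun k hk => eastHeight_wordOfHeights h0 hm hk⟩
  have h1 : (vertex (wordOfHeights h b) p).1 ≤ b := by
    conv_rhs => rw [← count_east_wordOfHeights h b]
    exact (List.take_sublist p _).count_le _
  have h2 := eastHeight_le_vertex_snd (wordOfHeights h b) p
  rw [eastHeight_wordOfHeights h0 hm h1] at h2
  have h3 := hc _ h1
  simp only [excess] at h3
  have h4 : a * (vertex (wordOfHeights h b) p).1 ≤ b * h (vertex (wordOfHeights h b) p).1 := by
    have : (a * (vertex (wordOfHeights h b) p).1 : ℤ) ≤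
      b * h (vertex (wordOfHeights h b) p).1 := by linarith
    exact_mod_cast this
  exact h4.trans (Nat.mul_le_mul_left b h2)

end DyckPath
end RatNC

namespace RatNC

/-! ### Set partitions and the Kreweras complement -/

section Finpartition

variable {α : Type*} [DecidableEq α] {s : Finset α} {π σ : Finpartition s} {i j k : α}

theorem SameBlock.trans (h1 : SameBlock π i j) (h2 : SameBlock π j k) : SameBlock π i k := by
  obtain ⟨B, hB, hi, hj⟩ := h1
  obtain ⟨C, hC, hj', hk⟩ := h2
  obtain rfl := π.eq_of_mem_parts hB hC hj hj'
  exact ⟨B, hB, hi, hk⟩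

theorem SameBlock.mem_left (h : SameBlock π i j) : i ∈ s := by
  obtain ⟨B, hB, hi, -⟩ := h
  exact π.le hB hi

theorem SameBlock.mem_right (h : SameBlock π i j) : j ∈ s := h.symm.mem_left

theorem SameBlock.refl (hi : i ∈ s) : SameBlock π i i :=
  ⟨π.part i, π.part_mem.2 hi, π.mem_part hi, π.mem_part hi⟩

theorem SameBlock.mem_iff {B : Finset α} (hB : B ∈ π.parts) (h : SameBlock π i j) :
    i ∈ B ↔ j ∈ B := by
  obtain ⟨C, hC, hi, hj⟩ := h
  constructor
  · intro h; obtain rfl := π.eq_of_mem_parts hB hC h hi; exact hj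
  · intro h; obtain rfl := π.eq_of_mem_parts hB hC h hj; exact hi

theorem le_of_sameBlock (h : ∀ i j, SameBlock π i j → SameBlock σ i j) : π ≤ σ := by
  intro B hB
  obtain ⟨i, hi⟩ := π.nonempty_of_mem_parts hB
  obtain ⟨C, hC, hiC, -⟩ := h i i ⟨B, hB, hi, hi⟩
  exact ⟨C, hC, fun j hj => (SameBlock.mem_iff hC (h i j ⟨B, hB, hi, hj⟩)).1 hiC⟩

theorem eq_of_sameBlock_iff (h : ∀ i j, SameBlock π i j ↔ SameBlock σ i j) : π = σ :=
  le_antisymm (le_of_sameBlock fun i j => (h i j).1) (le_of_sameBlock fun i j => (h i j).2)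

theorem SameBlock.mono (hle : π ≤ σ) (h : SameBlock π i j) : SameBlock σ i j := by
  obtain ⟨B, hB, hi, hj⟩ := h
  obtain ⟨C, hC, hBC⟩ := hle hB
  exact ⟨C, hC, hBC hi, hBC hj⟩

end Finpartition

variable {n : ℕ} {π : Finpartition (Finset.Icc 1 n)}

open Classical in
-- This makes the explicit relation a competitor in the maximality defining `krew`, which is known
-- only through that property.
theorem noncrossing_ofSetSetoid_krewSetoid (hπ : IsNoncrossing π) :
    NoncrossingRel (mergedRel π (Finpartition.ofSetSetoid (krewSetoid π) (Finset.Icc 1 n))) := by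
  have key := sameBlock_ofSetSetoid_iff (krewSetoid π) (Finset.Icc 1 n)
  rintro ⟨i, ci⟩ ⟨j, cj⟩ ⟨k, ck⟩ ⟨l, cl⟩ hij hjk hkl hik hjl
  change toLex (i, ci) < toLex (j, cj) at hij
  change toLex (j, cj) < toLex (k, ck) at hjk
  change toLex (k, ck) < toLex (l, cl) at hkl
  rw [Prod.Lex.toLex_lt_toLex] at hij hjk hkl
  rcases hik with ⟨h1, h2, hik⟩ | ⟨h1, h2, hik⟩ <;>
    rcases hjl with ⟨h3, h4, hjl⟩ | ⟨h3, h4, hjl⟩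
  all_goals
    change ci = _ at h1
    change ck = _ at h2
    change cj = _ at h3
    change cl = _ at h4
    subst h1 h2 h3 h4
    simp [show ¬ (true < false) by decide] at hij hjk hkl
  · obtain ⟨h1, h2, h3⟩ := hπ i j k l hij hjk hkl hik hjl
    exact ⟨Or.inl ⟨rfl, rfl, h1⟩, Or.inl ⟨rfl, rfl, h2⟩, Or.inl ⟨rfl, rfl, h3⟩⟩
  · have h := ((key j l).1 hjl).2.2 i k hik
    omega
  · have h := ((key i k).1 hik).2.2 j l hjl
    omega
  · obtain ⟨mi, mk, hik⟩ := (key i k).1 hik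
    obtain ⟨mj, ml, hjl⟩ := (key j l).1 hjl
    have e : (krewSetoid π) j k := by
      intro x y hxy
      have h1 := hik x y hxy
      have h2 := hjl x y hxy
      -- For `i < j < k < l`, the interval `(j, k]` is the intersection of `(i, k]` and `(j, l]`,
      -- and unions of blocks are closed under intersection.
      have q : ∀ z, (j < z ↔ k < z) ↔ ((i < z ↔ k < z) ∨ (j < z ↔ l < z)) := by
        intro z
        omega
      rw [q x, q y, h1, h2]
    have hij' := (key i j).2 ⟨mi, mj, (krewSetoid π).trans hik ((krewSetoid π).symm e)⟩
    have hjk' := (key j k).2 ⟨mj, mk, e⟩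
    have hkl' := (key k l).2 ⟨mk, ml, (krewSetoid π).trans ((krewSetoid π).symm e) hjl⟩
    exact ⟨Or.inr ⟨rfl, rfl, hij'⟩, Or.inr ⟨rfl, rfl, hjk'⟩, Or.inr ⟨rfl, rfl, hkl'⟩⟩

/-- For `i < j`, the elements `i'` and `j'` lie in a common block of the Kreweras complement if and
only if the interval `(i, j]` is a union of blocks of `π`. -/
theorem sameBlock_krew_iff (hπ : IsNoncrossing π) {i j : ℕ} (hij : i < j) :
    SameBlock (krew π hπ) i j ↔ i ∈ Finset.Icc 1 n ∧ j ∈ Finset.Icc 1 n ∧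
      ∀ x y, SameBlock π x y → ((i < x ∧ x ≤ j) ↔ (i < y ∧ y ≤ j)) := by
  classical
  have hk := krew_spec π hπ
  constructor
  · intro h
    refine ⟨h.mem_left, h.mem_right, fun x y hxy => ?_⟩
    have n1 : ¬ (i < x ∧ x ≤ j ∧ (y ≤ i ∨ j < y)) :=
      fun t => not_straddle hk.1 h hxy t.1 t.2.1 t.2.2
    have n2 : ¬ (i < y ∧ y ≤ j ∧ (x ≤ i ∨ j < x)) :=
      fun t => not_straddle hk.1 h hxy.symm t.1 t.2.1 t.2.2
    omega
  · rintro ⟨hi, hj, h⟩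
    refine SameBlock.mono (hk.2 (noncrossing_ofSetSetoid_krewSetoid hπ)) ?_
    refine (sameBlock_ofSetSetoid_iff _ _ _ _).2 ⟨hi, hj, fun x y hxy => ?_⟩
    have := h x y hxy
    omega

theorem noncrossing_krew (hπ : IsNoncrossing π) : NoncrossingRel (SameBlock (krew π hπ)) := by
  intro i j k l hij hjk hkl hik hjl
  have := (krew_spec π hπ).1 (toLex (i, true)) (toLex (j, true)) (toLex (k, true))
    (toLex (l, true)) (by simp [Prod.Lex.toLex_lt_toLex]; omega)
    (by simp [Prod.Lex.toLex_lt_toLex]; omega) (by simp [Prod.Lex.toLex_lt_toLex]; omega)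
    (Or.inr ⟨rfl, rfl, hik⟩) (Or.inr ⟨rfl, rfl, hjl⟩)
  simpa [mergedRel] using this

/-- Elements which no chord of the Kreweras complement separates lie in a common block. -/
theorem sameBlock_of_not_separated (hπ : IsNoncrossing π) {x y : ℕ} (hx : x ∈ Finset.Icc 1 n)
    (hy : y ∈ Finset.Icc 1 n)
    (h : ∀ i j, i < j → SameBlock (krew π hπ) i j → ((i < x ∧ x ≤ j) ↔ (i < y ∧ y ≤ j))) :
    SameBlock π x y := by
  classical
  wlog hxy : x < y generalizing x y
  · rcases (not_lt.1 hxy).eq_or_lt with rfl | hlt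
    · exact SameBlock.refl hx
    · exact (this hy hx (fun i j h1 h2 => (h i j h1 h2).symm) hlt).symm
  by_contra hc
  rw [Finset.mem_Icc] at hx hy
  let X := (Finset.Icc 1 n).filter (SameBlock π x)
  have hX : ∀ z, z ∈ X ↔ SameBlock π x z := fun z => by
    simp only [X, Finset.mem_filter, and_iff_right_iff_imp]; exact fun h => h.mem_right
  have hxX : SameBlock π x x := SameBlock.refl (by simp; omega)
  -- the last element of the block of `x` before `y`
  obtain ⟨u, hu, hu'⟩ : ∃ u, (SameBlock π x u ∧ u < y) ∧ ∀ z, SameBlock π x z → z < y → z ≤ u := by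
    obtain ⟨u, hu, hmax⟩ := (X.filter (· < y)).exists_max_image id
      ⟨x, by simp [hX, hxX, hxy]⟩
    simp only [Finset.mem_filter, hX, id] at hu hmax
    exact ⟨u, hu, fun z h1 h2 => hmax z ⟨h1, h2⟩⟩
  have hxu : x ≤ u := hu' x hxX hxy
  by_cases hR : ∃ z, SameBlock π x z ∧ y < z
  · -- the first element of the block of `x` after `y`
    obtain ⟨v, hv, hv'⟩ : ∃ v, (SameBlock π x v ∧ y < v) ∧
        ∀ z, SameBlock π x z → y < z → v ≤ z := by
      obtain ⟨z, hz⟩ := hR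
      obtain ⟨v, hv, hmin⟩ := (X.filter (y < ·)).exists_min_image id
        ⟨z, by simp [hX, hz]⟩
      simp only [Finset.mem_filter, hX, id] at hv hmin
      exact ⟨v, hv, fun z h1 h2 => hmin z ⟨h1, h2⟩⟩
    have hn := Finset.mem_Icc.1 hv.1.mem_right
    have huv : SameBlock π u v := hu.1.symm.trans hv.1
    -- The gap `(u, v - 1]` is a union of blocks: by noncrossing, a block leaving it would be the
    -- block of `x`, which has no element there.
    have hout : ∀ z w, SameBlock π z w → u < z → z ≤ v - 1 → u < w ∧ w ≤ v - 1 := by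
      intro z w hzw h1 h2
      by_contra hcon
      have hzx : SameBlock π x z := by
        rcases lt_trichotomy w u with h3 | rfl | h3
        · exact hu.1.trans (hπ w u z v h3 h1 (by omega) hzw.symm huv).2.1
        · exact hu.1.trans hzw.symm
        · rcases (show v ≤ w by omega).eq_or_lt with rfl | h4
          · exact hv.1.trans hzw.symm
          · exact hu.1.trans (hπ u z v w h1 (by omega) h4 huv hzw).1
      rcases lt_trichotomy z y with h3 | rfl | h3
      · have := hu' z hzx h3; omega
      · exact hc hzx
      · have := hv' z hzx h3; omega
    have hk : SameBlock (krew π hπ) u (v - 1) := by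
      rw [sameBlock_krew_iff hπ (by omega)]
      refine ⟨hu.1.mem_right, by rw [Finset.mem_Icc]; omega, fun z w hzw => ?_⟩
      exact ⟨fun h => hout z w hzw h.1 h.2, fun h => hout w z hzw.symm h.1 h.2⟩
    have := h _ _ (by omega) hk
    omega
  · have hle : ∀ z, SameBlock π x z → z ≤ u := by
      intro z hz
      refine hu' z hz ?_
      by_contra h1
      rcases (not_lt.1 h1).eq_or_lt with rfl | h2
      · exact hc hz
      · exact hR ⟨z, hz, h2⟩
    obtain ⟨v, hv, hv'⟩ : ∃ v, SameBlock π x v ∧ ∀ z, SameBlock π x z → v ≤ z := by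
      obtain ⟨v, hv, hmin⟩ := X.exists_min_image id ⟨x, by simp [hX, hxX]⟩
      simp only [hX, id] at hv hmin
      exact ⟨v, hv, hmin⟩
    have hvx := hv' x hxX
    have hn := Finset.mem_Icc.1 hv.mem_right
    have huv : SameBlock π v u := hv.symm.trans hu.1
    have hin : ∀ z w, SameBlock π z w → v ≤ z → z ≤ u → v ≤ w ∧ w ≤ u := by
      intro z w hzw h1 h2
      by_contra hcon
      have hzx : SameBlock π x z := by
        rcases h1.eq_or_lt with rfl | h1
        · exact hv
        rcases h2.eq_or_lt with rfl | h2
        · exact hu.1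
        rcases lt_or_ge w v with h3 | h3
        · exact hv.trans (hπ w v z u h3 h1 h2 hzw.symm huv).2.1
        · exact hv.trans (hπ v z u w h1 h2 (by omega) huv hzw).1
      have hwx := hzx.trans hzw
      exact hcon ⟨hv' w hwx, hle w hwx⟩
    -- The span `[v, u]` is a union of blocks. Its chord starts at `(v - 1)'`, which is missing when
    -- `v = 1`; then the complement `(u, n]` serves instead.
    rcases Nat.lt_or_ge 1 v with h1 | h1
    · have hk : SameBlock (krew π hπ) (v - 1) u := by
        rw [sameBlock_krew_iff hπ (by omega)]
        refine ⟨by rw [Finset.mem_Icc]; omega, hu.1.mem_right, fun z w hzw => ?_⟩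
        have h2 := hin z w hzw
        have h3 := hin w z hzw.symm
        omega
      have := h _ _ (by omega) hk
      omega
    · have hk : SameBlock (krew π hπ) u n := by
        rw [sameBlock_krew_iff hπ (by omega)]
        refine ⟨hu.1.mem_right, by rw [Finset.mem_Icc]; omega, fun z w hzw => ?_⟩
        have h2 := hin z w hzw
        have h3 := hin w z hzw.symm
        have h4 := Finset.mem_Icc.1 hzw.mem_left
        have h5 := Finset.mem_Icc.1 hzw.mem_right
        omega
      have := h _ _ (by omega) hk
      omega

end RatNC

namespace RatNC

/-! ### Arithmetic of admissible lasers -/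

theorem mul_sub_mul_ne_zero {a b : ℕ} (hcop : Nat.Coprime a b) {d : ℤ} (hd : 0 < d)
    (hdb : d < b) (r : ℤ) : (b * r - a * d : ℤ) ≠ 0 := by
  intro h
  have h1 : (b : ℤ) ∣ a * d := Dvd.intro r (by linarith)
  have h2 : IsCoprime (b : ℤ) a := Nat.isCoprime_iff_coprime.2 hcop.symm
  exact absurd (Int.le_of_dvd hd (h2.dvd_of_dvd_mul_left h1)) (by omega)

/-- The floor equation unfolds to these inequalities with `0 ≤`; coprimality makes the first strict,
and the range of `r` follows from `0 < m - i < b`. The quantity is the rise of the excess from `i`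
to `m` when the height rises by `r`. -/
theorem mem_admissibleLasers_iff {a b : ℕ} (ha : 0 < a) (hcop : Nat.Coprime a b) {i m : ℕ}
    (hi : 1 ≤ i) (him : i < m) (hm : m < b) :
    (i, m) ∈ admissibleLasers a b ↔
      ∃ r : ℤ, 0 < b * r - a * ((m : ℤ) - i) ∧ b * r - a * ((m : ℤ) - i) < a := by
  have ha' : (0 : ℝ) < a := by exact_mod_cast ha
  have hfloor : ∀ r : ℤ, (m : ℤ) - i = ⌊(r * b : ℝ) / a⌋ ↔
      0 ≤ b * r - a * ((m : ℤ) - i) ∧ b * r - a * ((m : ℤ) - i) < a := by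
    intro r
    rw [eq_comm, Int.floor_eq_iff, le_div_iff₀ ha', div_lt_iff₀ ha']
    have e1 : (((m : ℤ) - i : ℤ) * a : ℝ) ≤ r * b ↔ ((m : ℤ) - i) * a ≤ r * b := by
      exact_mod_cast Iff.rfl
    have e2 : ((r * b : ℝ) < (((m : ℤ) - i : ℤ) + 1) * a) ↔
        r * b < ((m : ℤ) - i + 1) * a := by
      exact_mod_cast Iff.rfl
    rw [e1, e2]
    constructor <;> rintro ⟨h1, h2⟩ <;> constructor <;> linarith
  simp only [admissibleLasers, Set.mem_ofPred_eq]
  constructor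
  · rintro ⟨-, -, -, r, -, -, hr⟩
    obtain ⟨h1, h2⟩ := (hfloor r).1 (by rw [Int.cast_natCast]; exact hr)
    exact ⟨r, lt_of_le_of_ne h1
      (mul_sub_mul_ne_zero hcop (by omega) (by omega) r).symm, h2⟩
  · rintro ⟨r, h1, h2⟩
    have hb0 : (0 : ℤ) < b := by omega
    have ha0 : (0 : ℤ) < a := by exact_mod_cast ha
    have hd : (0 : ℤ) < (m : ℤ) - i := by omega
    have hr0 : 0 < r := by
      have : 0 < b * r := by nlinarith
      exact pos_of_mul_pos_right this hb0.le
    have hra : r < a := by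
      have h3 : (m : ℤ) - i + 1 ≤ b := by omega
      have : b * r < b * a := by nlinarith
      exact lt_of_mul_lt_mul_left this hb0.le
    lift r to ℕ using hr0.le
    refine ⟨hi, him, by omega, r, by omega, by omega, ?_⟩
    have := (hfloor r).2 ⟨h1.le, h2⟩
    rwa [Int.cast_natCast] at this

theorem ceil_eq_of_sub {a b : ℕ} {r d : ℤ} (h0 : 0 ≤ b * r - a * d) (h1 : b * r - a * d < b)
    (hb : 0 < b) : ⌈(d : ℝ) * a / b⌉ = r := by
  have hb' : (0 : ℝ) < b := by exact_mod_cast hb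
  rw [Int.ceil_eq_iff, lt_div_iff₀ hb', div_le_iff₀ hb']
  constructor
  · have : (r - 1) * b < d * a := by linarith
    exact_mod_cast this
  · have : d * a ≤ r * b := by linarith
    exact_mod_cast this

/-! ### Sequences and their chords -/

/-- If the chords of `c` do not separate points of `(i, m]` from points outside, then `c` increases
at `i`. -/
theorem lt_succ_of_chords_respect {c : ℕ → ℤ} {n i m : ℕ} (hi : 1 ≤ i) (him : i < m)
    (hmn : m ≤ n) (hc0 : ∀ k, 1 ≤ k → k ≤ n → c 0 < c k)
    (hsat : ∀ x y, x ∈ Finset.Icc 1 n → y ∈ Finset.Icc 1 n →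
      (∀ l, 1 ≤ l → (AboveChord c l x ↔ AboveChord c l y)) →
      ((i < x ∧ x ≤ m) ↔ (i < y ∧ y ≤ m))) : c i < c (i + 1) := by
  by_contra hcon
  -- Take a minimum `q` of `c` on `(i, m]` and the last `l < q` with `c l < c q`. Without an ascent
  -- at `i`, `l < i`; yet no chord separates `q` from `l + 1`, although only `q` lies in `(i, m]`.
  obtain ⟨q, hq, hqmin⟩ := (Finset.Ioc i m).exists_min_image c ⟨m, by simp [him]⟩
  simp only [Finset.mem_Ioc] at hq hqmin
  obtain ⟨l, hl, hlmax⟩ := ((Finset.range q).filter (fun l => c l < c q)).exists_max_image id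
    ⟨0, by simpa using ⟨by omega, hc0 q (by omega) (by omega)⟩⟩
  simp only [Finset.mem_filter, Finset.mem_range, id] at hl hlmax
  have hli : l < i := by
    have h1 := hqmin (i + 1) ⟨by omega, by omega⟩
    by_contra h2
    rcases (not_lt.1 h2).eq_or_lt with rfl | h3
    · omega
    · have := hqmin l ⟨h3, by omega⟩
      omega
  have hge : ∀ k, l < k → k ≤ q → c q ≤ c k := by
    intro k h1 h2
    rcases h2.eq_or_lt with rfl | h2
    · exact le_rfl
    · by_contra h3
      have := hlmax k ⟨h2, not_le.1 h3⟩
      omega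
  have := hsat q (l + 1) (by simp; omega) (by simp; omega) (fun l' _ => ?_)
  · omega
  · constructor
    · rintro ⟨h1, h2⟩
      have := hlmax l' ⟨h1, h2 q h1 le_rfl⟩
      exact ⟨by omega, fun k h3 h4 => h2 k h3 (by omega)⟩
    · rintro ⟨h1, h2⟩
      refine ⟨by omega, fun k h3 h4 => ?_⟩
      rcases Nat.lt_or_ge l k with h5 | h5
      · have h6 := hge k h5 h4
        have h7 : c l' ≤ c l := by
          rcases (Nat.lt_succ_iff.1 h1).eq_or_lt with rfl | h8
          · exact le_rfl
          · exact (h2 l h8 (by omega)).le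
        omega
      · exact h2 k h3 (by omega)

/-! ### Heights with prescribed chords -/

/-- The solution of the recursion `x i = x (M i) - r i` if `i < M i` and `x i = x (i + 1)`
otherwise, with value `a` from `b` on. -/
def backSolve (a b : ℕ) (M : ℕ → ℕ) (r : ℕ → ℤ) (i : ℕ) : ℤ :=
  if i < b then
    if i < M i then backSolve a b M r (M i) - r i else backSolve a b M r (i + 1)
  else a
termination_by b - i

/-- Here `M i` is the last label of the chord of `i` and `r i` the height gained up to it. The
excess gains less than `a` from `i` to `M i` and then loses `a`, so the chord of `i` stops there. -/
theorem exists_height_of_chords {a b : ℕ} (hab : a < b) {M : ℕ → ℕ} {r : ℕ → ℤ}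
    (hM : ∀ i, 1 ≤ i → i < b → i ≤ M i ∧ M i < b)
    (hMM : ∀ i, 1 ≤ i → i < b → M (M i) = M i)
    (hnest : ∀ i k, 1 ≤ i → i < k → k ≤ M i → k < b → M k ≤ M i)
    (hr : ∀ i, 1 ≤ i → i < b → i < M i →
      0 < b * r i - a * ((M i : ℤ) - i) ∧ b * r i - a * ((M i : ℤ) - i) < a)
    (hord : ∀ i j, 1 ≤ i → i < j → j < b → M i = M j → j < M j →
      b * r j - a * ((M j : ℤ) - j) < b * r i - a * ((M i : ℤ) - i)) :
    ∃ h : ℕ → ℕ, h 0 = 0 ∧ Monotone h ∧ h b = a ∧ (∀ k ≤ b, 0 ≤ excess a b h k) ∧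
      ∀ i x, 1 ≤ i → i < b → x < b → (AboveChord (excess a b h) i x ↔ i < x ∧ x ≤ M i) := by
  set g := backSolve a b M r with hg
  have hb0 : (0 : ℤ) < b := by omega
  have gb : ∀ i, b ≤ i → g i = a := fun i hi => by
    rw [hg, backSolve, if_neg (not_lt.2 hi)]
  have gmax : ∀ i, i < b → M i = i → g i = g (i + 1) := fun i h1 h2 => by
    rw [hg, backSolve, if_pos h1, if_neg (by omega)]
  have gstep : ∀ i, i < b → i < M i → g i = g (M i) - r i := fun i h1 h2 => by
    rw [hg, backSolve, if_pos h1, if_pos h2]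
  obtain ⟨c, hc⟩ : ∃ c : ℕ → ℤ, ∀ k, c k = b * g k - a * k := ⟨_, fun _ => rfl⟩
  have cmax : ∀ i, i < b → M i = i → c (i + 1) = c i - a := fun i h1 h2 => by
    rw [hc, hc, gmax i h1 h2]; push_cast; ring
  have cstep : ∀ i, i < b → i < M i →
      c i = c (M i) - (b * r i - a * ((M i : ℤ) - i)) := fun i h1 h2 => by
    rw [hc, hc, gstep i h1 h2]; ring
  have cb : c b = 0 := by rw [hc, gb b le_rfl]; ring
  have key : ∀ k, 1 ≤ k → k < b → k < M k → c (M k + 1) < c k := by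
    intro k h1 h2 h3
    rw [cmax (M k) (hM k h1 h2).2 (hMM k h1 h2), cstep k h2 h3]
    have := (hr k h1 h2 h3).2
    omega
  have key' : ∀ k, 1 ≤ k → k < b → c (M k + 1) ≤ c k := by
    intro k h1 h2
    rcases (hM k h1 h2).1.eq_or_lt with h3 | h3
    · have := cmax k h2 h3.symm
      rw [← h3]
      omega
    · exact (key k h1 h2 h3).le
  -- Induction on the distance from `k` to `M i`. If `M k = M i`, compare through `hord`; otherwise
  -- `M k + 1` is still inside the chord of `i` and has excess at most that of `k`.
  have cover : ∀ d i k, 1 ≤ i → i < b → i < k → k ≤ M i → M i - k ≤ d → c i < c k := by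
    intro d
    induction d with
    | zero =>
      intro i k h1 h2 h3 h4 h5
      obtain rfl : k = M i := by omega
      rw [cstep i h2 h3]
      have := (hr i h1 h2 h3).1
      omega
    | succ d ih =>
      intro i k h1 h2 h3 h4 h5
      have hMi := hM i h1 h2
      have hkb : k < b := by omega
      have hMk := hM k (by omega) hkb
      rcases (hnest i k h1 h3 h4 hkb).eq_or_lt with h6 | h6
      · rcases hMk.1.eq_or_lt with h7 | h7
        · exact ih i k h1 h2 h3 h4 (by omega)
        · have h8 := hord i k h1 h3 hkb h6.symm h7
          rw [cstep i h2 (by omega), cstep k hkb h7, h6]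
          rw [h6] at h8
          omega
      · exact (ih i (M k + 1) h1 h2 (by omega) (by omega) (by omega)).trans_le
          (key' k (by omega) hkb)
  -- Jumping from `k` to `M k + 1` never increases `c`, and the jumps end at `c b = 0`.
  have cnn : ∀ d k, 1 ≤ k → k ≤ b → b - k ≤ d → 0 ≤ c k := by
    intro d
    induction d with
    | zero =>
      intro k h1 h2 h3
      obtain rfl : k = b := by omega
      exact cb.ge
    | succ d ih =>
      intro k h1 h2 h3
      rcases h2.eq_or_lt with rfl | h2
      · exact cb.ge
      · have hMk := hM k h1 h2
        exact (ih (M k + 1) (by omega) (by omega) (by omega)).trans (key' k h1 h2)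
  have gnn : ∀ k, 1 ≤ k → 0 ≤ g k := by
    intro k h1
    rcases Nat.lt_or_ge k b with h2 | h2
    · have h3 := cnn _ k h1 h2.le le_rfl
      rw [hc] at h3
      have : (0 : ℤ) ≤ a * k := by positivity
      exact nonneg_of_mul_nonneg_right (by linarith : 0 ≤ b * g k) hb0
    · rw [gb k h2]; positivity
  have gmono : ∀ k, 1 ≤ k → g k ≤ g (k + 1) := by
    intro k h1
    rcases Nat.lt_or_ge k b with h2 | h2
    · rcases (hM k h1 h2).1.eq_or_lt with h3 | h3
      · exact (gmax k h2 h3.symm).le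
      · have h4 := cover _ k (k + 1) h1 h2 (by omega) (by omega) le_rfl
        rw [hc, hc] at h4
        push_cast at h4
        have : (0 : ℤ) ≤ a := by positivity
        exact (lt_of_mul_lt_mul_left (by linarith : b * g k < b * g (k + 1)) hb0.le).le
    · rw [gb k h2, gb (k + 1) (by omega)]
  have hex : ∀ k, 1 ≤ k → excess a b (fun k => if k = 0 then 0 else (g k).toNat) k = c k := by
    intro k h1
    simp only [excess]
    rw [if_neg (by omega), Int.toNat_of_nonneg (gnn k h1), hc]
  -- The value at `0` is set separately, since `M 0` and `r 0` are arbitrary.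
  refine ⟨fun k => if k = 0 then 0 else (g k).toNat, rfl, ?_, ?_, ?_, ?_⟩
  · refine monotone_nat_of_le_succ fun k => ?_
    rcases Nat.eq_zero_or_pos k with rfl | h1
    · simp
    · simp only [Nat.succ_ne_zero, if_false, if_neg (show k ≠ 0 by omega)]
      exact Int.toNat_le_toNat (gmono k h1)
  · simp only
    rw [if_neg (by omega), gb b le_rfl, Int.toNat_natCast]
  · intro k hk
    rcases Nat.eq_zero_or_pos k with rfl | h1
    · simp [excess]
    · rw [hex k h1]
      exact cnn _ k h1 hk le_rfl
  · intro i x h1 h2 h3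
    constructor
    · rintro ⟨h4, h5⟩
      refine ⟨h4, ?_⟩
      by_contra h6
      have h7 := h5 (M i + 1) (by have := hM i h1 h2; omega) (by omega)
      rw [hex i h1, hex _ (by omega)] at h7
      exact absurd (key' i h1 h2) (not_le.2 h7)
    · rintro ⟨h4, h5⟩
      refine ⟨h4, fun k h6 h7 => ?_⟩
      rw [hex i h1, hex k (by omega)]
      exact cover _ i k h1 h2 h6 (by omega) le_rfl

end RatNC

/-! ### The two implications -/

namespace RatNC

namespace DyckPath

variable {a b : ℕ}

/-- A nonmaximal element of a block of the Kreweras complement of `π(D)` is a valley whose laser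
ends right after the maximum of the block. -/
theorem excess_of_mem_krew (D : DyckPath a b) (ha : 0 < a) (hab : a < b)
    (hcop : Nat.Coprime a b) (hπ : IsNoncrossing D.partition) {B : Finset ℕ}
    (hB : B ∈ (krew D.partition hπ).parts) {m : ℕ} (hm : IsGreatest (B : Set ℕ) m) {i : ℕ}
    (hi : i ∈ B) (him : i ≠ m) :
    (∀ k, i < k → k ≤ m → excess a b D.height i < excess a b D.height k) ∧
      excess a b D.height (m + 1) ≤ excess a b D.height i := by
  have hlt : i < m := lt_of_le_of_ne (hm.2 hi) him
  have hincr : ∀ j, j < m → SameBlock (krew D.partition hπ) j m →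
      excess a b D.height j < excess a b D.height (j + 1) := by
    intro j hj hjm
    obtain ⟨h1, h2, h3⟩ := (sameBlock_krew_iff hπ hj).1 hjm
    rw [Finset.mem_Icc] at h1 h2
    refine lt_succ_of_chords_respect h1.1 hj h2.2 (fun k h4 h5 => ?_) fun x y hx hy h => ?_
    · have := D.excess_pos hcop h4 (by omega)
      simpa [excess, D.height_zero] using this
    · exact h3 x y ((D.sameBlock_partition_iff ha hab x y).2 ⟨hx, hy, h⟩)
  have hImM : SameBlock (krew D.partition hπ) i m := ⟨B, hB, hi, hm.1⟩
  have hiI := Finset.mem_Icc.1 hImM.mem_left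
  have hmI := Finset.mem_Icc.1 hImM.mem_right
  obtain ⟨e, e1, e2, e3, e4⟩ := D.exists_laser_end (i := i) (by omega)
  have hie := hincr i hlt hImM
  have he : i + 1 < e := by
    refine lt_of_le_of_ne e1 ?_
    rintro rfl
    exact absurd e3 (not_le.2 hie)
  -- The chord of `i` is exactly `(i, e - 1]`, hence a union of blocks of `π(D)`.
  have hip : SameBlock (krew D.partition hπ) i (e - 1) := by
    rw [sameBlock_krew_iff hπ (by omega)]
    refine ⟨hImM.mem_left, by rw [Finset.mem_Icc]; omega, fun x y hxy => ?_⟩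
    obtain ⟨-, -, h⟩ := (D.sameBlock_partition_iff ha hab x y).1 hxy
    have hchord : ∀ z, AboveChord (excess a b D.height) i z ↔ i < z ∧ z ≤ e - 1 := by
      refine fun z => ⟨fun h => ⟨h.1, ?_⟩, fun h => ⟨h.1, fun k h1 h2 => e4 k h1 (by omega)⟩⟩
      by_contra hc
      exact absurd e3 (not_le.2 (h.2 e e1 (by omega)))
    rw [← hchord, ← hchord]
    exact h i hiI.1
  have hpm : e - 1 ≤ m := hm.2 ((SameBlock.mem_iff hB hip).1 hi)
  -- If `e - 1 < m`, the ascent at `e - 1` would put the excess at `e` above that at `i`.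
  have hpe : e - 1 = m := by
    by_contra hc
    have h1 := hincr (e - 1) (by omega) (hip.symm.trans hImM)
    have h2 := e4 (e - 1) (by omega) (by omega)
    rw [Nat.sub_add_cancel (by omega)] at h1
    omega
  have hme : m + 1 = e := by omega
  rw [hme]
  exact ⟨fun k h1 h2 => e4 k h1 (by omega), e3⟩

/-- The height difference along a laser. -/
theorem laser_bounds (D : DyckPath a b) (hcop : Nat.Coprime a b)
    {i m : ℕ} (hi : 1 ≤ i) (him : i < m) (hmb : m < b)
    (h1 : ∀ k, i < k → k ≤ m → excess a b D.height i < excess a b D.height k)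
    (h2 : excess a b D.height (m + 1) ≤ excess a b D.height i) :
    0 < b * ((D.height m : ℤ) - D.height i) - a * ((m : ℤ) - i) ∧
      b * ((D.height m : ℤ) - D.height i) - a * ((m : ℤ) - i) < a := by
  have h3 := h1 m him le_rfl
  have h4 := D.excess_succ_ge m
  have e : b * ((D.height m : ℤ) - D.height i) - a * ((m : ℤ) - i) =
      excess a b D.height m - excess a b D.height i := by simp only [excess]; ring
  refine ⟨by omega, lt_of_le_of_ne (by omega) fun h => ?_⟩
  -- Equality with `a` would make `b` divide `a * (m - i + 1)`, where `0 < m - i + 1 < b`.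
  refine mul_sub_mul_ne_zero hcop (d := (m : ℤ) - i + 1) (by omega) (by omega)
    ((D.height m : ℤ) - D.height i) ?_
  linarith

end DyckPath

/-- Turns condition 2 into a comparison of excesses: of two elements of a block, the earlier one
lies further below the excess of the maximum. -/
theorem lt_sub_iff_excess_lt {a b : ℕ} (hb : 0 < b) {i j m : ℕ} (r s : ℤ) :
    ((r : ℝ) - s > ((j : ℝ) - i) * a / b) ↔
      b * s - a * ((m : ℤ) - j) < b * r - a * ((m : ℤ) - i) := by
  have hb' : (0 : ℝ) < b := by exact_mod_cast hb
  rw [gt_iff_lt, div_lt_iff₀ hb']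
  have : ((j : ℝ) - i) * a < (r - s) * b ↔ ((j : ℤ) - i) * a < (r - s) * b := by
    exact_mod_cast Iff.rfl
  rw [this]
  constructor <;> intro h <;> linarith

/-- The rounded-up height of a laser is the integer which witnesses its admissibility. -/
theorem ceil_laser {a b : ℕ} (hab : a < b) {i m : ℕ} {r : ℤ}
    (h : 0 < b * r - a * ((m : ℤ) - i) ∧ b * r - a * ((m : ℤ) - i) < a) :
    ⌈((m : ℝ) - i) * a / b⌉ = r := by
  have := ceil_eq_of_sub (r := r) (d := (m : ℤ) - i) h.1.le (h.2.trans (by omega)) (by omega)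
  push_cast at this
  exact this

theorem krew_conditions_of_mem_rationalNC (a b : ℕ) (ha : 0 < a) (hab : a < b)
    (hcop : Nat.Coprime a b) (D : DyckPath a b) (hπ : IsNoncrossing D.partition)
    {B : Finset ℕ} (hB : B ∈ (krew D.partition hπ).parts) {m : ℕ}
    (hm : IsGreatest (B : Set ℕ) m) :
    (∀ i ∈ B, i ≠ m → (i, m) ∈ admissibleLasers a b) ∧
      (∀ i ∈ B, ∀ j ∈ B, i ≠ m → j ≠ m → i < j →
        ((⌈((m : ℝ) - i) * a / b⌉ : ℝ) - ⌈((m : ℝ) - j) * a / b⌉) > ((j : ℝ) - i) * a / b) := by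
  have hI : ∀ i ∈ B, 1 ≤ i ∧ i ≤ b - 1 := fun i hi =>
    Finset.mem_Icc.1 ((krew D.partition hπ).le hB hi)
  have hmb := hI m hm.1
  have hbounds : ∀ i ∈ B, i ≠ m →
      0 < b * ((D.height m : ℤ) - D.height i) - a * ((m : ℤ) - i) ∧
        b * ((D.height m : ℤ) - D.height i) - a * ((m : ℤ) - i) < a := by
    intro i hi him
    obtain ⟨h1, h2⟩ := D.excess_of_mem_krew ha hab hcop hπ hB hm hi him
    exact D.laser_bounds hcop (hI i hi).1 (lt_of_le_of_ne (hm.2 hi) him) (by omega) h1 h2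
  constructor
  · intro i hi him
    exact (mem_admissibleLasers_iff ha hcop (hI i hi).1 (lt_of_le_of_ne (hm.2 hi) him)
      (by omega)).2 ⟨_, hbounds i hi him⟩
  · intro i hi j hj him hjm hij
    rw [ceil_laser hab (hbounds i hi him), ceil_laser hab (hbounds j hj hjm),
      lt_sub_iff_excess_lt (m := m) (by omega)]
    have h1 := (D.excess_of_mem_krew ha hab hcop hπ hB hm hi him).1 j hij (hm.2 hj)
    simp only [excess] at h1
    linarith

theorem mem_rationalNC_of_krew_conditions (a b : ℕ) (ha : 0 < a) (hab : a < b)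
    (hcop : Nat.Coprime a b) (π : Finpartition (Finset.Icc 1 (b - 1))) (hπ : IsNoncrossing π)
    (H : ∀ B ∈ (krew π hπ).parts, ∀ m : ℕ, IsGreatest (B : Set ℕ) m →
      (∀ i ∈ B, i ≠ m → (i, m) ∈ admissibleLasers a b) ∧
      (∀ i ∈ B, ∀ j ∈ B, i ≠ m → j ≠ m → i < j →
        ((⌈((m : ℝ) - i) * a / b⌉ : ℝ) - ⌈((m : ℝ) - j) * a / b⌉) > ((j : ℝ) - i) * a / b)) :
    π ∈ rationalNC a b := by
  have hmem : ∀ i, 1 ≤ i → i < b → i ∈ Finset.Icc 1 (b - 1) := fun i h1 h2 => by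
    rw [Finset.mem_Icc]; omega
  have hex : ∀ i, ∃ m, 1 ≤ i → i < b →
      SameBlock (krew π hπ) i m ∧ ∀ z, SameBlock (krew π hπ) i z → z ≤ m := by
    intro i
    by_cases hi : 1 ≤ i ∧ i < b
    · obtain ⟨B, hB, h1, -⟩ := SameBlock.refl (π := krew π hπ) (hmem i hi.1 hi.2)
      obtain ⟨m, hm, hmax⟩ := B.exists_max_image id ⟨i, h1⟩
      exact ⟨m, fun _ _ => ⟨⟨B, hB, h1, hm⟩, fun z hz =>
        hmax z ((SameBlock.mem_iff hB hz).1 h1)⟩⟩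
    · exact ⟨0, fun h1 h2 => absurd ⟨h1, h2⟩ hi⟩
  choose M hM using hex
  have hMb : ∀ i, 1 ≤ i → i < b → i ≤ M i ∧ 1 ≤ M i ∧ M i < b := by
    intro i h1 h2
    have h3 := (hM i h1 h2).2 i (SameBlock.refl (hmem i h1 h2))
    have h4 := Finset.mem_Icc.1 (hM i h1 h2).1.mem_right
    omega
  have hMeq : ∀ i j, 1 ≤ i → i < b → 1 ≤ j → j < b → SameBlock (krew π hπ) i j → M i = M j := by
    intro i j h1 h2 h3 h4 h
    exact le_antisymm ((hM j h3 h4).2 _ (h.symm.trans (hM i h1 h2).1))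
      ((hM i h1 h2).2 _ (h.trans (hM j h3 h4).1))
  have hgreat : ∀ i, 1 ≤ i → i < b → ∃ B ∈ (krew π hπ).parts, i ∈ B ∧ M i ∈ B ∧
      IsGreatest (B : Set ℕ) (M i) := by
    intro i h1 h2
    obtain ⟨⟨B, hB, hi, hm⟩, hmax⟩ := hM i h1 h2
    exact ⟨B, hB, hi, hm, hm, fun z hz => hmax z ⟨B, hB, hi, hz⟩⟩
  have hr : ∀ i, ∃ r : ℤ, 1 ≤ i → i < b → i < M i →
      0 < b * r - a * ((M i : ℤ) - i) ∧ b * r - a * ((M i : ℤ) - i) < a := by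
    intro i
    by_cases hi : 1 ≤ i ∧ i < b ∧ i < M i
    · obtain ⟨B, hB, h1, h2, h3⟩ := hgreat i hi.1 hi.2.1
      obtain ⟨r, hr⟩ := (mem_admissibleLasers_iff ha hcop hi.1 hi.2.2
        (hMb i hi.1 hi.2.1).2.2).1 ((H B hB _ h3).1 i h1 hi.2.2.ne)
      exact ⟨r, fun _ _ _ => hr⟩
    · exact ⟨0, fun h1 h2 h3 => absurd ⟨h1, h2, h3⟩ hi⟩
  choose r hr using hr
  obtain ⟨h, h0, hmono, hlast, hnn, hchord⟩ := exists_height_of_chords hab (M := M) (r := r)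
    (fun i h1 h2 => ⟨(hMb i h1 h2).1, (hMb i h1 h2).2.2⟩)
    (fun i h1 h2 => (hMeq i (M i) h1 h2 (hMb i h1 h2).2.1 (hMb i h1 h2).2.2 (hM i h1 h2).1).symm)
    -- Chords nest because the Kreweras complement is itself noncrossing.
    (fun i k h1 h2 h3 h4 => by
      by_contra hc
      have hi : i < b := by omega
      rcases h3.eq_or_lt with h5 | h5
      · have := hMeq i k h1 hi (by omega) h4 (h5 ▸ (hM i h1 hi).1)
        omega
      · have := (noncrossing_krew hπ i k (M i) (M k) h2 h5 (by omega) (hM i h1 hi).1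
          (hM k (by omega) h4).1).1
        have := hMeq i k h1 hi (by omega) h4 this
        omega)
    hr
    (fun i j h1 h2 h3 h4 h5 => by
      have hi : i < b := by omega
      have hj : 1 ≤ j := by omega
      obtain ⟨B, hB, b1, b2, b3⟩ := hgreat i h1 hi
      have hjB : j ∈ B := by
        refine (SameBlock.mem_iff hB ((hM i h1 hi).1.trans ?_)).1 b1
        rw [h4]
        exact (hM j hj h3).1.symm
      have hri := hr i h1 hi (by omega)
      have hrj := hr j hj h3 h5
      rw [← h4] at hrj h5 ⊢
      have h6 := (H B hB _ b3).2 i b1 j hjB (by omega) (by omega) h2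
      rw [ceil_laser hab hri, ceil_laser hab hrj] at h6
      exact (lt_sub_iff_excess_lt (by omega) _ _).1 h6)
  obtain ⟨D, hD⟩ := DyckPath.exists_of_height h0 hmono hlast hnn
  refine ⟨D, eq_of_sameBlock_iff fun x y => ?_⟩
  have hchord' : ∀ i x, 1 ≤ i → i < b → x < b →
      (AboveChord (excess a b D.height) i x ↔ i < x ∧ x ≤ M i) := by
    intro i x h1 h2 h3
    rw [← hchord i x h1 h2 h3]
    refine and_congr_right fun _ => forall_congr' fun k => imp_congr_right fun _ =>
      imp_congr_right fun h4 => ?_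
    simp only [excess, hD i h2.le, hD k (by omega)]
  rw [D.sameBlock_partition_iff ha hab]
  constructor
  · rintro ⟨hx, hy, hxy⟩
    refine sameBlock_of_not_separated hπ hx hy ?_
    rw [Finset.mem_Icc] at hx hy
    intro i j hij hk
    have hi := Finset.mem_Icc.1 hk.mem_left
    have hj := Finset.mem_Icc.1 hk.mem_right
    have hi' := hxy i hi.1
    have hj' := hxy j hj.1
    rw [hchord' i x (by omega) (by omega) (by omega),
      hchord' i y (by omega) (by omega) (by omega)] at hi'
    rw [hchord' j x (by omega) (by omega) (by omega),
      hchord' j y (by omega) (by omega) (by omega),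
      ← hMeq i j (by omega) (by omega) (by omega) (by omega) hk] at hj'
    -- Only chords ending at block maxima come from `D`, but `(i, j]` is the difference of `(i, M
    -- i]` and `(j, M i]`.
    have := (hM i (by omega) (by omega)).2 j hk
    omega
  · intro hxy
    have hx := Finset.mem_Icc.1 hxy.mem_left
    have hy := Finset.mem_Icc.1 hxy.mem_right
    refine ⟨hxy.mem_left, hxy.mem_right, fun i h1 => ?_⟩
    by_cases hib : i < b
    · rw [hchord' i x h1 hib (by omega), hchord' i y h1 hib (by omega)]
      rcases (hMb i h1 hib).1.eq_or_lt with h2 | h2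
      · omega
      · exact ((sameBlock_krew_iff hπ h2).1 (hM i h1 hib).1).2.2 x y hxy
    · exact iff_of_false (fun h => by have := h.1; omega) (fun h => by have := h.1; omega)

end RatNC

theorem mainTheorem9 (a b : ℕ) (ha : 0 < a) (hab : a < b) (hcop : Nat.Coprime a b)
    (π : Finpartition (Finset.Icc 1 (b - 1))) (hπ : RatNC.IsNoncrossing π) :
    π ∈ RatNC.rationalNC a b ↔
      ∀ B ∈ (RatNC.krew π hπ).parts, ∀ m : ℕ, IsGreatest (B : Set ℕ) m →
        (∀ i ∈ B, i ≠ m → (i, m) ∈ RatNC.admissibleLasers a b) ∧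
        (∀ i ∈ B, ∀ j ∈ B, i ≠ m → j ≠ m → i < j →
          ((⌈((m : ℝ) - i) * a / b⌉ : ℝ) - ⌈((m : ℝ) - j) * a / b⌉) > ((j : ℝ) - i) * a / b) := by
  constructor
  · rintro ⟨D, rfl⟩ B hB m hm
    exact RatNC.krew_conditions_of_mem_rationalNC a b ha hab hcop D hπ hB hm
  · exact RatNC.mem_rationalNC_of_krew_conditions a b ha hab hcop π hπ
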